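/- Let $G$ be a locally compact, second countable Hausdorff topological group. Let $\mathcal{R}=(U_{\mathcal R},\mathsf{E}_{\mathcal R},\mathcal{H}_{\mathcal R})$ be a principal quantum reference frame: $\mathcal{H}_{\mathcal R}\neq 0$ is a complex Hilbert space, $U_{\mathcal R}$ is a strongly continuous unitary representation of $G$ on $\mathcal{H}_{\mathcal R}$, and $\mathsf{E}_{\mathcal R}$ is a normalized positive operator-valued measure on the Borel sets of a principal homogeneous $G$-space $\Sigma$ (a topological $G$-space all of whose orbit maps $g\mapsto g.o$ are homeomorphisms $G\to\Sigma$), with values in $B(\mathcal{H}_{\mathcal R})$, which is covariant: $\mathsf{E}_{\mathcal R}(g.X)=U_{\mathcal R}(g)\mathsf{E}_{\mathcal R}(X)U_{\mathcal R}(g)^*$. Fix a base point $o\in\Sigma$ and identify $\Sigma$ with $G$ through $g\mapsto g.o$. Let $U_{\mathcal S}$ be a strongly continuous unitary representation of $G$ on a complex Hilbert space $\mathcal{H}_{\mathcal S}$, and let $B(\mathcal{H}_{\mathcal R}\otimes\mathcal{H}_{\mathcal S})^G$ be the space of bounded operators invariant under conjugation by all $U_{\mathcal R}(g)\otimes U_{\mathcal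 S}(g)$. The relativization map $$\yen^{\mathcal R}: B(\mathcal{H}_{\mathcal S})\to B(\mathcal{H}_{\mathcal R}\otimes\mathcal{H}_{\mathcal S})^G,\qquad \yen^{\mathcal R}(A)=\int_G d\mathsf{E}_{\mathcal R}(g)\otimes U_{\mathcal S}(g)AU_{\mathcal S}(g)^*,$$ is the linear map determined by $$\langle\varphi\otimes\psi,\ \yen^{\mathcal R}(A)\,(\varphi\otimes\psi)\rangle=\int_G\langle\psi,\,U_{\mathcal S}(g)AU_{\mathcal S}(g)^*\psi\rangle\, d\langle\varphi,\mathsf{E}_{\mathcal R}(g)\varphi\rangle\qquad(\varphi\in\mathcal{H}_{\mathcal R},\ \psi\in\mathcal{H}_{\mathcal S}).$$ Suppose that $\mathcal{R}$ is localizable, that is, $\|\mathsf{E}_{\mathcal R}(X)\|=1$ for every Borel set $X$ with $\mathsf{E}_{\mathcal R}(X)\neq 0$. Then $\yen^{\mathcal R}$ is isometric, $\|\yen^{\mathcal R}(A)\|=\|A\|$ for all $A\in B(\mathcal{H}_{\mathcal S})$; in particular it is injective. -/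

import Mathlib

open scoped TensorProduct InnerProductSpace
open MeasureTheory Filter Topology

noncomputable section


/-- A (normalized) positive operator-valued measure on the measurable space `Ω` with values in the
bounded operators of the Hilbert space `H`, countably additive in the weak operator topology.
Only the values on measurable sets matter. -/
structure POVM (Ω : Type*) [MeasurableSpace Ω] (H : Type*) [NormedAddCommGroup H]
    [InnerProductSpace ℂ H] where
  /-- The effect attached to a measurable set. -/
  effect : Set Ω → (H →L[ℂ] H)
  effect_isPositive : ∀ X, MeasurableSet X → (effect X).IsPositive
  effect_univ : effect Set.univ = 1
  effect_hasSum : ∀ X : ℕ → Set Ω, (∀ n, MeasurableSet (X n)) →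
    Pairwise (fun m n => Disjoint (X m) (X n)) →
    ∀ φ ψ : H, HasSum (fun n => ⟪φ, effect (X n) ψ⟫_ℂ) ⟪φ, effect (⋃ n, X n) ψ⟫_ℂ

namespace POVM

variable {Ω : Type*} [MeasurableSpace Ω] {H : Type*} [NormedAddCommGroup H]
  [InnerProductSpace ℂ H] (E : POVM Ω H)

/-- The norm-1 property: every non-zero effect has norm one. -/
def IsLocalizable : Prop :=
  ∀ X, MeasurableSet X → E.effect X ≠ 0 → ‖E.effect X‖ = 1

theorem effect_empty_inner (φ ψ : H) : ⟪φ, E.effect ∅ ψ⟫_ℂ = 0 := by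
  have h := E.effect_hasSum (fun _ => ∅) (fun _ => MeasurableSet.empty)
    (fun _ _ _ => disjoint_bot_left) φ ψ
  exact tendsto_nhds_unique tendsto_const_nhds h.summable.tendsto_atTop_zero

theorem re_inner_effect_nonneg {X : Set Ω} (hX : MeasurableSet X) (φ : H) :
    0 ≤ (⟪φ, E.effect X φ⟫_ℂ).re :=
  (E.effect_isPositive X hX).re_inner_nonneg_right φ

theorem inner_effect_eq_re {X : Set Ω} (hX : MeasurableSet X) (φ : H) :
    ⟪φ, E.effect X φ⟫_ℂ = ((⟪φ, E.effect X φ⟫_ℂ).re : ℂ) := by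
  have h := (E.effect_isPositive X hX).inner_nonneg_right φ
  exact Complex.ext rfl (by simpa using (Complex.le_def.1 h).2.symm)

/-- The outcome measure `X ↦ ⟨φ, E(X) φ⟩` of the vector `φ`
(the Born distribution if `φ` is a unit vector). -/
def outcomeMeasure (φ : H) : Measure Ω :=
  Measure.ofMeasurable (fun X _ => ENNReal.ofReal (⟪φ, E.effect X φ⟫_ℂ).re)
    (by simp [E.effect_empty_inner]) (by
      intro X hX hd
      have h := E.effect_hasSum X hX hd φ φ
      have h' : HasSum (fun n => (⟪φ, E.effect (X n) φ⟫_ℂ).re)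
          (⟪φ, E.effect (⋃ n, X n) φ⟫_ℂ).re := Complex.hasSum_re h
      rw [← h'.tsum_eq]
      exact ENNReal.ofReal_tsum_of_nonneg (fun n => E.re_inner_effect_nonneg (hX n) φ) h'.summable)

theorem outcomeMeasure_apply {X : Set Ω} (hX : MeasurableSet X) (φ : H) :
    E.outcomeMeasure φ X = ENNReal.ofReal (⟪φ, E.effect X φ⟫_ℂ).re :=
  Measure.ofMeasurable_apply X hX

theorem outcomeMeasure_real {X : Set Ω} (hX : MeasurableSet X) (φ : H) :
    ((E.outcomeMeasure φ).real X : ℂ) = ⟪φ, E.effect X φ⟫_ℂ := by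
  rw [Measure.real, E.outcomeMeasure_apply hX, ENNReal.toReal_ofReal
    (E.re_inner_effect_nonneg hX φ), ← E.inner_effect_eq_re hX]

theorem outcomeMeasure_univ (φ : H) :
    (E.outcomeMeasure φ) Set.univ = ENNReal.ofReal (‖φ‖ ^ 2) := by
  rw [E.outcomeMeasure_apply MeasurableSet.univ, E.effect_univ]
  simp [inner_self_eq_norm_sq_to_K, ← Complex.ofReal_pow]

instance (φ : H) : IsFiniteMeasure (E.outcomeMeasure φ) :=
  ⟨by rw [E.outcomeMeasure_univ]; exact ENNReal.ofReal_lt_top⟩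

end POVM

section HilbertTensor

variable {H K : Type*} [NormedAddCommGroup H] [InnerProductSpace ℂ H]
  [NormedAddCommGroup K] [InnerProductSpace ℂ K]

/-- The Hilbert space tensor product: the completion of the algebraic tensor product. -/
abbrev HilbertTensor (H K : Type*) [NormedAddCommGroup H] [InnerProductSpace ℂ H]
    [NormedAddCommGroup K] [InnerProductSpace ℂ K] : Type _ :=
  UniformSpace.Completion (H ⊗[ℂ] K)

/-- The product vector `φ ⊗ ψ` in the Hilbert space tensor product. -/
def prodVec (φ : H) (ψ : K) : HilbertTensor H K := ((φ ⊗ₜ[ℂ] ψ : H ⊗[ℂ] K) : HilbertTensor H K)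

/-- The tensor product `A ⊗ B` of bounded operators on the Hilbert space tensor product. -/
def prodOp (A : H →L[ℂ] H) (B : K →L[ℂ] K) : HilbertTensor H K →L[ℂ] HilbertTensor H K :=
  (TensorProduct.mapL A B).completion

@[simp] theorem prodOp_prodVec (A : H →L[ℂ] H) (B : K →L[ℂ] K) (φ : H) (ψ : K) :
    prodOp A B (prodVec φ ψ) = prodVec (A φ) (B ψ) := by
  simp [prodOp, prodVec]

theorem inner_prodVec (φ φ' : H) (ψ ψ' : K) :
    ⟪prodVec φ ψ, prodVec φ' ψ'⟫_ℂ = ⟪φ, φ'⟫_ℂ * ⟪ψ, ψ'⟫_ℂ := by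
  simp [prodVec]

theorem prodVec_add_left (φ φ' : H) (ψ : K) :
    prodVec (φ + φ') ψ = prodVec φ ψ + prodVec φ' ψ := by
  simp [prodVec, TensorProduct.add_tmul, UniformSpace.Completion.coe_add]

theorem prodVec_add_right (φ : H) (ψ ψ' : K) :
    prodVec φ (ψ + ψ') = prodVec φ ψ + prodVec φ ψ' := by
  simp [prodVec, TensorProduct.tmul_add, UniformSpace.Completion.coe_add]

theorem prodVec_smul_left (c : ℂ) (φ : H) (ψ : K) :
    prodVec (c • φ) ψ = c • prodVec φ ψ := by
  simp [prodVec, ← TensorProduct.smul_tmul', UniformSpace.Completion.coe_smul]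

theorem prodVec_smul_right (c : ℂ) (φ : H) (ψ : K) :
    prodVec φ (c • ψ) = c • prodVec φ ψ := by
  simp [prodVec, UniformSpace.Completion.coe_smul]

/-- Operators on the tensor product are determined by their matrix elements between
product vectors. -/
theorem prodOp_ext {S T : HilbertTensor H K →L[ℂ] HilbertTensor H K}
    (h : ∀ φ φ' ψ ψ', ⟪prodVec φ ψ, S (prodVec φ' ψ')⟫_ℂ = ⟪prodVec φ ψ, T (prodVec φ' ψ')⟫_ℂ) :
    S = T := by
  have key : ∀ x y : HilbertTensor H K, ⟪x, S y⟫_ℂ = ⟪x, T y⟫_ℂ := by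
    intro x y
    induction x, y using UniformSpace.Completion.induction_on₂ with
    | hp => exact isClosed_eq (by fun_prop) (by fun_prop)
    | ih a b =>
      induction a using TensorProduct.induction_on with
      | zero => simp [UniformSpace.Completion.coe_zero]
      | add a a' ha ha' =>
        simp only [UniformSpace.Completion.coe_add, inner_add_left, ha, ha']
      | tmul φ ψ =>
        induction b using TensorProduct.induction_on with
        | zero => simp [UniformSpace.Completion.coe_zero]
        | add a a' ha ha' =>
          simp only [UniformSpace.Completion.coe_add, map_add, inner_add_right, ha, ha']
        | tmul φ' ψ' => exact h φ φ' ψ ψ'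
  ext y
  exact ext_inner_left ℂ fun x => key x y

theorem sesq_eq_zero {V : Type*} [AddCommGroup V] [Module ℂ V] (b : V → V → ℂ)
    (hl : ∀ x y z, b (x + y) z = b x z + b y z) (hr : ∀ x y z, b x (y + z) = b x y + b x z)
    (hls : ∀ (c : ℂ) x y, b (c • x) y = (starRingEnd ℂ) c * b x y)
    (hrs : ∀ (c : ℂ) x y, b x (c • y) = c * b x y) (h : ∀ x, b x x = 0) (x y : V) :
    b x y = 0 := by
  have h1 := h (x + y)
  have h2 := h (x + Complex.I • y)
  simp only [hl, hr, hls, hrs, h, Complex.conj_I] at h1 h2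
  have h3 : Complex.I * (b x y - b y x) = 0 := by linear_combination h2
  have h4 : b x y - b y x = 0 := by simpa using h3
  linear_combination (h1 + h4) / 2

/-- Operators on the tensor product are determined by their expectation values in
product vectors. -/
theorem prodOp_ext_diag {S T : HilbertTensor H K →L[ℂ] HilbertTensor H K}
    (h : ∀ φ ψ, ⟪prodVec φ ψ, S (prodVec φ ψ)⟫_ℂ = ⟪prodVec φ ψ, T (prodVec φ ψ)⟫_ℂ) :
    S = T := by
  refine prodOp_ext fun φ φ' ψ ψ' => ?_
  have h1 : ∀ φ ψ ψ', ⟪prodVec φ ψ, (S - T) (prodVec φ ψ')⟫_ℂ = 0 := fun φ ψ ψ' =>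
    sesq_eq_zero (fun ψ ψ' => ⟪prodVec φ ψ, (S - T) (prodVec φ ψ')⟫_ℂ)
      (by intros; simp only [prodVec_add_right, inner_add_left])
      (by intros; simp only [prodVec_add_right, map_add, inner_add_right])
      (by intros; simp only [prodVec_smul_right, inner_smul_left])
      (by intros; simp only [prodVec_smul_right, map_smul, inner_smul_right])
      (by intro ψ; simp [inner_sub_right, h]) ψ ψ'
  have h2 := sesq_eq_zero (fun φ φ' => ⟪prodVec φ ψ, (S - T) (prodVec φ' ψ')⟫_ℂ)
      (by intros; simp only [prodVec_add_left, inner_add_left])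
      (by intros; simp only [prodVec_add_left, map_add, inner_add_right])
      (by intros; simp only [prodVec_smul_left, inner_smul_left])
      (by intros; simp only [prodVec_smul_left, map_smul, inner_smul_right])
      (fun φ => h1 φ ψ ψ') φ φ'
  simpa [inner_sub_right, sub_eq_zero] using h2

theorem prodOp_mul (A A' : H →L[ℂ] H) (B B' : K →L[ℂ] K) :
    prodOp A B * prodOp A' B' = prodOp (A * A') (B * B') :=
  prodOp_ext fun φ φ' ψ ψ' => by simp

theorem prodOp_one : prodOp (1 : H →L[ℂ] H) (1 : K →L[ℂ] K) = 1 :=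
  prodOp_ext fun φ φ' ψ ψ' => by simp

theorem prodOp_adjoint [CompleteSpace H] [CompleteSpace K] (A : H →L[ℂ] H) (B : K →L[ℂ] K) :
    ContinuousLinearMap.adjoint (prodOp A B) =
      prodOp (ContinuousLinearMap.adjoint A) (ContinuousLinearMap.adjoint B) :=
  prodOp_ext fun φ φ' ψ ψ' => by
    simp [ContinuousLinearMap.adjoint_inner_right, inner_prodVec]

theorem norm_prodOp_le (A : H →L[ℂ] H) (B : K →L[ℂ] K) : ‖prodOp A B‖ ≤ ‖A‖ * ‖B‖ := by
  refine ContinuousLinearMap.opNorm_le_bound _ (by positivity) fun x => ?_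
  induction x using UniformSpace.Completion.induction_on with
  | hp => exact isClosed_le (by fun_prop) (by fun_prop)
  | ih a =>
    simp only [prodOp, ContinuousLinearMap.completion_apply_coe, UniformSpace.Completion.norm_coe]
    exact (ContinuousLinearMap.le_opNorm _ _).trans
      (mul_le_mul_of_nonneg_right (TensorProduct.norm_mapL_le A B) (norm_nonneg _))

end HilbertTensor

section OperatorIntegral

variable {Ω : Type*} [MeasurableSpace Ω] {H K : Type*} [NormedAddCommGroup H]
  [InnerProductSpace ℂ H] [NormedAddCommGroup K] [InnerProductSpace ℂ K]

/-- `T = ∫ dE(x) ⊗ f(x)`: the bounded operator `T` on `H ⊗ K` satisfies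
`⟨φ ⊗ ψ, T (φ ⊗ ψ)⟩ = ∫ ⟨ψ, f(x) ψ⟩ d⟨φ, E(x) φ⟩` for all vectors `φ`, `ψ`. -/
def IsOperatorIntegral (E : POVM Ω H) (f : Ω → (K →L[ℂ] K))
    (T : HilbertTensor H K →L[ℂ] HilbertTensor H K) : Prop :=
  ∀ (φ : H) (ψ : K),
    ⟪prodVec φ ψ, T (prodVec φ ψ)⟫_ℂ = ∫ x, ⟪ψ, f x ψ⟫_ℂ ∂(E.outcomeMeasure φ)

theorem IsOperatorIntegral.unique {E : POVM Ω H} {f : Ω → (K →L[ℂ] K)}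
    {S T : HilbertTensor H K →L[ℂ] HilbertTensor H K}
    (hS : IsOperatorIntegral E f S) (hT : IsOperatorIntegral E f T) : S = T :=
  prodOp_ext_diag fun φ ψ => (hS φ ψ).trans (hT φ ψ).symm

theorem norm_inner_apply_le {f : Ω → (K →L[ℂ] K)} {M : ℝ} (hM : ∀ x, ‖f x‖ ≤ M) (ψ : K) (x : Ω) :
    ‖⟪ψ, f x ψ⟫_ℂ‖ ≤ M * ‖ψ‖ ^ 2 :=
  calc ‖⟪ψ, f x ψ⟫_ℂ‖ ≤ ‖ψ‖ * ‖f x ψ‖ := norm_inner_le_norm _ _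
    _ ≤ ‖ψ‖ * (M * ‖ψ‖) := by
      gcongr
      exact (f x).le_of_opNorm_le (hM x) ψ
    _ = M * ‖ψ‖ ^ 2 := by ring

theorem integrable_inner_apply (E : POVM Ω H) {f : Ω → (K →L[ℂ] K)} {M : ℝ}
    (hM : ∀ x, ‖f x‖ ≤ M) (hf : ∀ ψ, Measurable fun x => ⟪ψ, f x ψ⟫_ℂ) (φ : H) (ψ : K) :
    Integrable (fun x => ⟪ψ, f x ψ⟫_ℂ) (E.outcomeMeasure φ) :=
  Integrable.of_bound (hf ψ).aestronglyMeasurable (M * ‖ψ‖ ^ 2)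
    (Eventually.of_forall fun x => norm_inner_apply_le hM ψ x)

theorem sum_effect_fiber (E : POVM Ω H) (κ : SimpleFunc Ω ℕ) (N : ℕ) (hκ : ∀ x, κ x ≤ N) :
    ∑ k ∈ Finset.range (N + 1), E.effect (κ ⁻¹' {k}) = 1 := by
  ext ψ
  refine ext_inner_left ℂ fun φ => ?_
  have h := E.effect_hasSum (fun k => κ ⁻¹' {k}) (fun k => κ.measurableSet_fiber k)
    (fun m n hmn => Disjoint.preimage _ (by simpa using hmn)) φ ψ
  have hU : (⋃ k, κ ⁻¹' {k}) = Set.univ := by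
    ext x; simp
  rw [hU, E.effect_univ] at h
  rw [← h.tsum_eq, tsum_eq_sum (s := Finset.range (N + 1))]
  · simp [inner_sum]
  · intro k hk
    have : κ ⁻¹' {k} = ∅ := by
      ext x
      simp only [Set.mem_preimage, Set.mem_singleton_iff, Set.mem_empty_iff_false, iff_false]
      rintro rfl
      exact hk (Finset.mem_range.2 (Nat.lt_succ_of_le (hκ x)))
    rw [this, E.effect_empty_inner]

/-- Riemann sums `∑ E(X_k) ⊗ F_k` over a partition are bounded by `sup ‖F_k‖`. -/
theorem norm_riemannSum_le [CompleteSpace H] [CompleteSpace K] (s : Finset ℕ)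
    (A : ℕ → (H →L[ℂ] H)) (hA : ∀ k ∈ s, (A k).IsPositive) (hsum : ∑ k ∈ s, A k = 1)
    (F : ℕ → (K →L[ℂ] K)) {M : ℝ} (hM0 : 0 ≤ M) (hM : ∀ k, ‖F k‖ ≤ M) :
    ‖∑ k ∈ s, prodOp (A k) (F k)‖ ≤ M := by
  set S : ℕ → (H →L[ℂ] H) := fun k => CFC.sqrt (A k) with hS
  have hSA : ∀ k ∈ s, S k * S k = A k := fun k hk =>
    CFC.sqrt_mul_sqrt_self _ ((ContinuousLinearMap.nonneg_iff_isPositive _).2 (hA k hk))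
  have hSadj : ∀ k, ContinuousLinearMap.adjoint (S k) = S k := fun k =>
    (IsSelfAdjoint.of_nonneg (CFC.sqrt_nonneg (A k))).star_eq
  set R : ℕ → (HilbertTensor H K →L[ℂ] HilbertTensor H K) := fun k => prodOp (S k) 1 with hR
  have hRadj : ∀ k, ContinuousLinearMap.adjoint (R k) = R k := fun k => by
    have h1 : ContinuousLinearMap.adjoint (1 : K →L[ℂ] K) = 1 := star_one _
    simp only [hR, prodOp_adjoint, hSadj, h1]
  have hone : ∑ k ∈ s, prodOp (A k) (1 : K →L[ℂ] K) = 1 := by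
    refine prodOp_ext fun φ φ' ψ ψ' => ?_
    simp only [sum_apply, inner_sum, prodOp_prodVec, inner_prodVec,
      one_apply_eq_self, ← Finset.sum_mul]
    rw [← inner_sum, ← sum_apply, hsum, one_apply_eq_self]
  have hsq : ∀ x : HilbertTensor H K, ∑ k ∈ s, ‖R k x‖ ^ 2 = ‖x‖ ^ 2 := by
    intro x
    have h1 : ∀ k ∈ s, ((‖R k x‖ ^ 2 : ℝ) : ℂ) = ⟪x, prodOp (A k) (1 : K →L[ℂ] K) x⟫_ℂ := by
      intro k hk
      have h2 : prodOp (A k) (1 : K →L[ℂ] K) = R k * R k := by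
        simp [hR, prodOp_mul, hSA k hk]
      rw [h2, mul_apply_eq_comp, ← ContinuousLinearMap.adjoint_inner_left, hRadj,
        inner_self_eq_norm_sq_to_K]
      simp
    have h3 : ((∑ k ∈ s, ‖R k x‖ ^ 2 : ℝ) : ℂ) = ((‖x‖ ^ 2 : ℝ) : ℂ) := by
      rw [Complex.ofReal_sum, Finset.sum_congr rfl h1, ← inner_sum,
        ← sum_apply, hone, one_apply_eq_self,
        inner_self_eq_norm_sq_to_K]
      simp
    exact_mod_cast h3
  have hterm : ∀ x y : HilbertTensor H K, ∀ k ∈ s,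
      ‖⟪x, prodOp (A k) (F k) y⟫_ℂ‖ ≤ M * (‖R k x‖ * ‖R k y‖) := by
    intro x y k hk
    have h2 : prodOp (A k) (F k) = R k * (prodOp 1 (F k) * R k) := by
      simp [hR, prodOp_mul, hSA k hk]
    rw [h2, mul_apply_eq_comp, ← ContinuousLinearMap.adjoint_inner_left, hRadj,
      mul_apply_eq_comp]
    have h4 : ‖prodOp (1 : H →L[ℂ] H) (F k)‖ ≤ M :=
      (norm_prodOp_le _ _).trans <| by
        calc ‖(1 : H →L[ℂ] H)‖ * ‖F k‖ ≤ 1 * M := by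
              gcongr
              · exact ContinuousLinearMap.norm_id_le
              · exact hM k
          _ = M := one_mul M
    calc _ ≤ ‖R k x‖ * ‖prodOp (1 : H →L[ℂ] H) (F k) (R k y)‖ := norm_inner_le_norm _ _
      _ ≤ ‖R k x‖ * (M * ‖R k y‖) := by
        gcongr
        exact ContinuousLinearMap.le_of_opNorm_le _ h4 _
      _ = _ := by ring
  have hbound : ∀ x y : HilbertTensor H K,
      ‖⟪x, (∑ k ∈ s, prodOp (A k) (F k)) y⟫_ℂ‖ ≤ M * (‖x‖ * ‖y‖) := by
    intro x y
    rw [sum_apply, inner_sum]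
    calc _ ≤ ∑ k ∈ s, ‖⟪x, prodOp (A k) (F k) y⟫_ℂ‖ := norm_sum_le _ _
      _ ≤ ∑ k ∈ s, M * (‖R k x‖ * ‖R k y‖) := Finset.sum_le_sum (hterm x y)
      _ = M * ∑ k ∈ s, ‖R k x‖ * ‖R k y‖ := (Finset.mul_sum _ _ _).symm
      _ ≤ M * (√(∑ k ∈ s, ‖R k x‖ ^ 2) * √(∑ k ∈ s, ‖R k y‖ ^ 2)) := by
        gcongr
        exact Real.sum_mul_le_sqrt_mul_sqrt _ _ _
      _ = M * (‖x‖ * ‖y‖) := by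
        rw [hsq, hsq, Real.sqrt_sq (norm_nonneg _), Real.sqrt_sq (norm_nonneg _)]
  refine ContinuousLinearMap.opNorm_le_bound _ hM0 fun y => ?_
  set z := (∑ k ∈ s, prodOp (A k) (F k)) y with hz
  have h5 := hbound z y
  rw [← hz, inner_self_eq_norm_sq_to_K] at h5
  have h6 : ‖z‖ ^ 2 ≤ M * (‖z‖ * ‖y‖) := by simpa using h5
  rcases (norm_nonneg z).eq_or_lt with h0 | h0
  · rw [← h0]; positivity
  · nlinarith

/-- One Riemann sum approximating the expectation values in finitely many vectors `ψ`. -/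
theorem exists_approx_operatorIntegral [CompleteSpace H] [CompleteSpace K] [Nonempty Ω]
    (E : POVM Ω H) {f : Ω → (K →L[ℂ] K)} {M : ℝ} (hM : ∀ x, ‖f x‖ ≤ M)
    (hf : ∀ ψ, Measurable fun x => ⟪ψ, f x ψ⟫_ℂ) (s : Finset K) {ε : ℝ} (hε : 0 < ε) :
    ∃ T : HilbertTensor H K →L[ℂ] HilbertTensor H K, ‖T‖ ≤ M ∧ ∀ φ, ∀ ψ ∈ s,
      ‖⟪prodVec φ ψ, T (prodVec φ ψ)⟫_ℂ - ∫ x, ⟪ψ, f x ψ⟫_ℂ ∂(E.outcomeMeasure φ)‖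
        ≤ ε * ‖φ‖ ^ 2 := by
  classical
  have hM0 : 0 ≤ M := (norm_nonneg _).trans (hM (Classical.arbitrary Ω))
  set h : Ω → (s → ℂ) := fun x ψ => ⟪(ψ : K), f x ψ⟫_ℂ with hh
  have hmeas : Measurable h := measurable_pi_iff.2 fun ψ => hf ψ
  have hbdd : Bornology.IsBounded (Set.range h) := by
    refine isBounded_iff_forall_norm_le.2 ⟨∑ ψ ∈ s, M * ‖ψ‖ ^ 2, ?_⟩
    rintro _ ⟨x, rfl⟩
    refine (pi_norm_le_iff_of_nonneg (Finset.sum_nonneg fun _ _ => by positivity)).2 fun ψ => ?_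
    exact (norm_inner_apply_le hM (ψ : K) x).trans
      (Finset.single_le_sum (f := fun ψ : K => M * ‖ψ‖ ^ 2) (fun _ _ => by positivity) ψ.2)
  obtain ⟨t, hts, htf, ht⟩ :=
    (totallyBounded_iff_subset.1 (hbdd.isCompact_closure.totallyBounded.subset subset_closure)) _ (Metric.dist_mem_uniformity hε)
  have hchoice : ∀ z ∈ t, ∃ x, h x = z := fun z hz => hts hz
  -- enumerate tags
  have htne : t.Nonempty := by
    obtain ⟨x⟩ := ‹Nonempty Ω›
    have := ht ⟨x, rfl⟩
    simp only [Set.mem_iUnion] at this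
    obtain ⟨z, hz, -⟩ := this
    exact ⟨z, hz⟩
  obtain ⟨e, he⟩ := htf.countable.exists_eq_range htne
  have htag : ∀ k, ∃ x, h x = e k := fun k => hchoice _ (he ▸ ⟨k, rfl⟩)
  choose y hy using htag
  obtain ⟨N, hN⟩ : ∃ N, ∀ z ∈ t, ∃ k ≤ N, e k = z := by
    have : ∀ z ∈ t, ∃ k, e k = z := fun z hz => by rw [he] at hz; exact hz
    choose! j hj using this
    refine ⟨htf.toFinset.sup j, fun z hz => ⟨j z, ?_, hj z hz⟩⟩
    exact Finset.le_sup (f := j) (htf.mem_toFinset.2 hz)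
  set κ : SimpleFunc Ω ℕ := (SimpleFunc.nearestPtInd e N).comp h hmeas with hκ
  have hκN : ∀ x, κ x ≤ N := fun x => SimpleFunc.nearestPtInd_le _ _ _
  have hclose : ∀ x, dist (h (y (κ x))) (h x) ≤ ε := by
    intro x
    have := ht ⟨x, rfl⟩
    simp only [Set.mem_iUnion] at this
    obtain ⟨z, hz, hxz⟩ := this
    obtain ⟨k, hk, rfl⟩ := hN z hz
    have h1 := SimpleFunc.edist_nearestPt_le e (h x) hk
    rw [edist_dist, edist_dist, ENNReal.ofReal_le_ofReal_iff dist_nonneg] at h1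
    rw [hy]
    refine h1.trans ?_
    rw [dist_comm]
    exact le_of_lt hxz
  refine ⟨∑ k ∈ Finset.range (N + 1), prodOp (E.effect (κ ⁻¹' {k})) (f (y k)),
    norm_riemannSum_le _ _ (fun k _ => E.effect_isPositive _ (κ.measurableSet_fiber k))
      (sum_effect_fiber E κ N hκN) _ hM0 (fun k => hM _), fun φ ψ hψ => ?_⟩
  set μ := E.outcomeMeasure φ with hμ
  have hsum : ⟪prodVec φ ψ, (∑ k ∈ Finset.range (N + 1),
      prodOp (E.effect (κ ⁻¹' {k})) (f (y k))) (prodVec φ ψ)⟫_ℂ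
      = ∫ x, ⟪ψ, f (y (κ x)) ψ⟫_ℂ ∂μ := by
    have h1 : (fun x => ⟪ψ, f (y (κ x)) ψ⟫_ℂ) = fun x => ∑ k ∈ Finset.range (N + 1),
        (κ ⁻¹' {k}).indicator (fun _ => ⟪ψ, f (y k) ψ⟫_ℂ) x := by
      funext x
      rw [Finset.sum_eq_single (κ x)]
      · simp
      · intro k _ hk
        simp [Set.indicator, hk.symm]
      · intro hk
        exact absurd (Finset.mem_range.2 (Nat.lt_succ_of_le (hκN x))) hk
    rw [h1, integral_finsetSum _ fun k _ =>
      (integrable_const _).indicator (κ.measurableSet_fiber k)]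
    simp only [sum_apply, inner_sum, prodOp_prodVec, inner_prodVec]
    refine Finset.sum_congr rfl fun k _ => ?_
    rw [integral_indicator_const _ (κ.measurableSet_fiber k),
      ← E.outcomeMeasure_real (κ.measurableSet_fiber k), Complex.real_smul]
  have hint : Integrable (fun x => ⟪ψ, f (y (κ x)) ψ⟫_ℂ) μ := by
    refine Integrable.of_bound (C := M * ‖ψ‖ ^ 2) ?_
      (Eventually.of_forall fun x => norm_inner_apply_le hM ψ _)
    exact (κ.map fun k => ⟪ψ, f (y k) ψ⟫_ℂ).measurable.aestronglyMeasurable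
  rw [hsum, ← integral_sub hint (integrable_inner_apply E hM hf φ ψ)]
  have hb := norm_integral_le_of_norm_le_const (μ := μ) (C := ε)
    (f := fun x => ⟪ψ, f (y (κ x)) ψ⟫_ℂ - ⟪ψ, f x ψ⟫_ℂ)
    (Eventually.of_forall fun x => by
      have h2 := (dist_le_pi_dist (h (y (κ x))) (h x) ⟨ψ, hψ⟩).trans (hclose x)
      rwa [dist_eq_norm] at h2)
  rwa [Measure.real, E.outcomeMeasure_univ, ENNReal.toReal_ofReal (by positivity)] at hb

/-- Bounded, weakly measurable operator-valued functions have an operator integral, which is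
bounded by their supremum norm. -/
theorem exists_isOperatorIntegral [CompleteSpace H] [CompleteSpace K]
    (E : POVM Ω H) {f : Ω → (K →L[ℂ] K)} {M : ℝ} (hM0 : 0 ≤ M) (hM : ∀ x, ‖f x‖ ≤ M)
    (hf : ∀ ψ, Measurable fun x => ⟪ψ, f x ψ⟫_ℂ) :
    ∃ T : HilbertTensor H K →L[ℂ] HilbertTensor H K, ‖T‖ ≤ M ∧ IsOperatorIntegral E f T := by
  classical
  rcases isEmpty_or_nonempty Ω with hΩ | hΩ
  · refine ⟨0, (norm_zero (E := HilbertTensor H K →L[ℂ] HilbertTensor H K)).trans_le hM0, fun φ ψ => ?_⟩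
    have : E.outcomeMeasure φ = 0 := Measure.eq_zero_of_isEmpty _
    simp [this]
  choose T hTM hT using fun i : Finset K × ℕ =>
    exists_approx_operatorIntegral E hM hf i.1 (ε := 1 / ((i.2 : ℝ) + 1)) (by positivity)
  set 𝒰 : Ultrafilter (Finset K × ℕ) := Ultrafilter.of atTop with h𝒰
  have h𝒰le : (𝒰 : Filter (Finset K × ℕ)) ≤ atTop := Ultrafilter.of_le _
  have hbd : ∀ x y i, ‖⟪x, T i y⟫_ℂ‖ ≤ M * ‖x‖ * ‖y‖ := fun x y i =>
    calc _ ≤ ‖x‖ * ‖T i y‖ := norm_inner_le_norm _ _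
      _ ≤ ‖x‖ * (M * ‖y‖) := by
        gcongr
        exact ContinuousLinearMap.le_of_opNorm_le _ (hTM i) _
      _ = _ := by ring
  have hlim : ∀ x y, ∃ b : ℂ, Tendsto (fun i => ⟪x, T i y⟫_ℂ) 𝒰 (𝓝 b) := by
    intro x y
    obtain ⟨b, -, hb⟩ := (isCompact_closedBall (0 : ℂ) (M * ‖x‖ * ‖y‖)).ultrafilter_le_nhds
      (𝒰.map fun i => ⟪x, T i y⟫_ℂ) (by
        rw [le_principal_iff]
        refine Ultrafilter.mem_map.2 (Filter.univ_mem' fun i => ?_)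
        simpa using hbd x y i)
    exact ⟨b, hb⟩
  choose b hb using hlim
  have hbb : ∀ x y, ‖b x y‖ ≤ M * ‖x‖ * ‖y‖ := fun x y =>
    le_of_tendsto (f := fun i => ‖⟪x, T i y⟫_ℂ‖) (hb x y).norm
      (Eventually.of_forall fun i => hbd x y i)
  let B : HilbertTensor H K →L⋆[ℂ] HilbertTensor H K →L[ℂ] ℂ :=
    (LinearMap.mk₂'ₛₗ (starRingEnd ℂ) (RingHom.id ℂ) b
      (fun x x' y => tendsto_nhds_unique (hb _ _)
        (by simpa only [inner_add_left] using (hb x y).add (hb x' y)))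
      (fun c x y => tendsto_nhds_unique (hb _ _)
        (by simpa only [inner_smul_left, smul_eq_mul] using (hb x y).const_mul _))
      (fun x y y' => tendsto_nhds_unique (hb _ _)
        (by simpa only [map_add, inner_add_right] using (hb x y).add (hb x y')))
      (fun c x y => tendsto_nhds_unique (hb _ _)
        (by
          simpa only [map_smul, inner_smul_right, smul_eq_mul, RingHom.id_apply] using
            (hb x y).const_mul c))).mkContinuous₂ M
      hbb
  have hB : ∀ x y, B x y = b x y := fun x y => rfl
  refine ⟨ContinuousLinearMap.adjoint (InnerProductSpace.continuousLinearMapOfBilin B), ?_,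
    fun φ ψ => ?_⟩
  · rw [LinearIsometryEquiv.norm_map]
    refine ContinuousLinearMap.opNorm_le_bound _ hM0 fun v => ?_
    have h1 : ‖InnerProductSpace.continuousLinearMapOfBilin B v‖ = ‖B v‖ :=
      (InnerProductSpace.toDual ℂ (HilbertTensor H K)).symm.norm_map (B v)
    rw [h1]
    exact ContinuousLinearMap.le_of_opNorm_le _ (LinearMap.mkContinuous₂_norm_le _ hM0 _) v
  rw [ContinuousLinearMap.adjoint_inner_right,
    InnerProductSpace.continuousLinearMapOfBilin_apply, hB]
  refine tendsto_nhds_unique (hb _ _) ?_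
  rw [tendsto_iff_norm_sub_tendsto_zero]
  refine squeeze_zero' (g := fun i : Finset K × ℕ => 1 / ((i.2 : ℝ) + 1) * ‖φ‖ ^ 2)
    (Eventually.of_forall fun i => norm_nonneg _) ?_ ?_
  · refine h𝒰le ?_
    filter_upwards [eventually_ge_atTop (({ψ}, 0) : Finset K × ℕ)] with i hi
    exact hT i φ ψ (hi.1 (Finset.mem_singleton_self ψ))
  · have h1 : Tendsto (fun i : Finset K × ℕ => 1 / ((i.2 : ℝ) + 1)) atTop (𝓝 0) :=
      (tendsto_one_div_add_atTop_nhds_zero_nat (𝕜 := ℝ)).comp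
        (by rw [← prod_atTop_atTop_eq]; exact tendsto_snd)
    simpa using (h1.mono_left h𝒰le).mul_const (‖φ‖ ^ 2)

end OperatorIntegral

section Frames

/-- A strongly continuous unitary representation of the topological group `G` on `H`. -/
structure UnitaryRep (G : Type*) [Group G] [TopologicalSpace G] (H : Type*)
    [NormedAddCommGroup H] [InnerProductSpace ℂ H] [CompleteSpace H] where
  /-- The unitary operators. -/
  U : G →* unitary (H →L[ℂ] H)
  continuous_U : ∀ φ : H, Continuous fun g => (U g : H →L[ℂ] H) φ

variable {G : Type*} [Group G] [TopologicalSpace G] {Ω : Type*} [MeasurableSpace Ω]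
  {H K : Type*} [NormedAddCommGroup H] [InnerProductSpace ℂ H] [CompleteSpace H]
  [NormedAddCommGroup K] [InnerProductSpace ℂ K] [CompleteSpace K]

/-- The action `g.A = U(g) A U(g)^*` on bounded operators. -/
def UnitaryRep.conj (V : UnitaryRep G H) (g : G) (A : H →L[ℂ] H) : H →L[ℂ] H :=
  (V.U g : H →L[ℂ] H) * A * star (V.U g : H →L[ℂ] H)

/-- A quantum reference frame: a system of covariance, i.e. a strongly continuous unitary
representation on `H` together with a covariant POVM on a homogeneous `G`-space `Ω`. -/
structure QuantumReferenceFrame (G : Type*) [Group G] [TopologicalSpace G]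
    (Ω : Type*) [TopologicalSpace Ω] [MeasurableSpace Ω] [BorelSpace Ω] [MulAction G Ω]
    [ContinuousSMul G Ω] [MulAction.IsPretransitive G Ω]
    (H : Type*) [NormedAddCommGroup H] [InnerProductSpace ℂ H] [CompleteSpace H] where
  /-- The representation of the group on the Hilbert space of the frame. -/
  rep : UnitaryRep G H
  /-- The frame observable. -/
  povm : POVM Ω H
  covariant : ∀ (g : G) (X : Set Ω), MeasurableSet X →
    povm.effect ((fun x => g • x) '' X) = rep.conj g (povm.effect X)

/-- A frame is localizable if its observable has the norm-1 property. -/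
def QuantumReferenceFrame.IsLocalizable [TopologicalSpace Ω] [BorelSpace Ω] [MulAction G Ω]
    [ContinuousSMul G Ω] [MulAction.IsPretransitive G Ω] (R : QuantumReferenceFrame G Ω H) : Prop :=
  R.povm.IsLocalizable

/-- `Ω` is a principal homogeneous `G`-space (a torsor): each orbit map `g ↦ g • o` identifies
`G` with `Ω`, also topologically. -/
def IsPrincipalHomogeneousSpace (G : Type*) [Group G] [TopologicalSpace G]
    (Ω : Type*) [TopologicalSpace Ω] [MulAction G Ω] : Prop :=
  ∀ o : Ω, IsHomeomorph fun g : G => g • o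

/-- The inverse of the orbit map of the base point `o`: `groupCoord h o x` is the unique `g : G`
with `g • o = x`. -/
def groupCoord [TopologicalSpace Ω] [MulAction G Ω] (hΩ : IsPrincipalHomogeneousSpace G Ω)
    (o : Ω) : Ω ≃ₜ G :=
  ((hΩ o).homeomorph _).symm

theorem groupCoord_smul_base [TopologicalSpace Ω] [MulAction G Ω]
    (hΩ : IsPrincipalHomogeneousSpace G Ω) (o x : Ω) : groupCoord hΩ o x • o = x :=
  ((hΩ o).homeomorph _).apply_symm_apply x

theorem groupCoord_smul [TopologicalSpace Ω] [MulAction G Ω]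
    (hΩ : IsPrincipalHomogeneousSpace G Ω) (o : Ω) (g : G) (x : Ω) :
    groupCoord hΩ o (g • x) = g * groupCoord hΩ o x := by
  apply (hΩ o).bijective.1
  simp only [groupCoord_smul_base, mul_smul]

/-- The space `B(H ⊗ K)^G` of bounded operators on `H ⊗ K` that are invariant under the diagonal
action `g ↦ V(g) ⊗ W(g)`, as a subspace of `B(H ⊗ K)`. -/
def invariantOperators (V : UnitaryRep G H) (W : UnitaryRep G K) :
    Submodule ℂ (HilbertTensor H K →L[ℂ] HilbertTensor H K) where
  carrier := {T | ∀ g : G, prodOp (V.U g : H →L[ℂ] H) (W.U g : K →L[ℂ] K) * T *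
    star (prodOp (V.U g : H →L[ℂ] H) (W.U g : K →L[ℂ] K)) = T}
  zero_mem' := fun g => by simp
  add_mem' := fun {S T} hS hT g => by rw [mul_add, add_mul, hS g, hT g]
  smul_mem' := fun c T hT g => by rw [mul_smul_comm, smul_mul_assoc, hT g]

theorem UnitaryRep.star_U (V : UnitaryRep G H) (g : G) :
    star (V.U g : H →L[ℂ] H) = (V.U g⁻¹ : H →L[ℂ] H) := by
  rw [map_inv]; rfl

theorem UnitaryRep.norm_conj_le (V : UnitaryRep G H) (g : G) (A : H →L[ℂ] H) :
    ‖V.conj g A‖ ≤ ‖A‖ := by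
  rw [UnitaryRep.conj, ← Unitary.coe_star, CStarRing.norm_mul_coe_unitary,
    CStarRing.norm_coe_unitary_mul]

theorem UnitaryRep.inner_conj (V : UnitaryRep G H) (g : G) (A : H →L[ℂ] H) (φ ψ : H) :
    ⟪φ, V.conj g A ψ⟫_ℂ = ⟪(V.U g⁻¹ : H →L[ℂ] H) φ, A ((V.U g⁻¹ : H →L[ℂ] H) ψ)⟫_ℂ := by
  rw [UnitaryRep.conj, V.star_U, mul_apply_eq_comp, mul_apply_eq_comp, ← V.star_U,
    ContinuousLinearMap.star_eq_adjoint, ContinuousLinearMap.adjoint_inner_left]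

theorem UnitaryRep.conj_mul (V : UnitaryRep G H) (g h : G) (A : H →L[ℂ] H) :
    V.conj (g * h) A = V.conj g (V.conj h A) := by
  simp [UnitaryRep.conj, map_mul, mul_assoc]

theorem UnitaryRep.continuous_inner_conj [IsTopologicalGroup G] (V : UnitaryRep G H)
    (A : H →L[ℂ] H) (φ ψ : H) : Continuous fun g => ⟪φ, V.conj g A ψ⟫_ℂ := by
  simp only [V.inner_conj]
  have h : ∀ φ, Continuous fun g : G => (V.U g⁻¹ : H →L[ℂ] H) φ := fun φ =>
    (V.continuous_U φ).comp continuous_inv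
  exact (h φ).inner (A.continuous.comp (h ψ))

variable [IsTopologicalGroup G] [TopologicalSpace Ω] [BorelSpace Ω] [MulAction G Ω]
  [ContinuousSMul G Ω] [MulAction.IsPretransitive G Ω]

/-- The integral defining the relativization of a bounded operator exists. -/
theorem exists_relativization (hΩ : IsPrincipalHomogeneousSpace G Ω) (o : Ω)
    (R : QuantumReferenceFrame G Ω H) (W : UnitaryRep G K) (A : K →L[ℂ] K) :
    ∃ T : HilbertTensor H K →L[ℂ] HilbertTensor H K, ‖T‖ ≤ ‖A‖ ∧
      IsOperatorIntegral R.povm (fun x => W.conj (groupCoord hΩ o x) A) T :=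
  exists_isOperatorIntegral R.povm (norm_nonneg A) (fun _ => W.norm_conj_le _ A) fun ψ =>
    ((W.continuous_inner_conj A ψ ψ).comp (groupCoord hΩ o).continuous).measurable

/-- The bounded operator `∫ dE(g) ⊗ U(g) A U(g)^*`, where `Ω` is identified with `G` through the
base point `o`. -/
def relativizationOp (hΩ : IsPrincipalHomogeneousSpace G Ω) (o : Ω)
    (R : QuantumReferenceFrame G Ω H) (W : UnitaryRep G K) (A : K →L[ℂ] K) :
    HilbertTensor H K →L[ℂ] HilbertTensor H K :=
  (exists_relativization hΩ o R W A).choose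

theorem relativizationOp_spec (hΩ : IsPrincipalHomogeneousSpace G Ω) (o : Ω)
    (R : QuantumReferenceFrame G Ω H) (W : UnitaryRep G K) (A : K →L[ℂ] K) :
    IsOperatorIntegral R.povm (fun x => W.conj (groupCoord hΩ o x) A)
      (relativizationOp hΩ o R W A) :=
  (exists_relativization hΩ o R W A).choose_spec.2

theorem integrable_relativization (hΩ : IsPrincipalHomogeneousSpace G Ω) (o : Ω)
    (R : QuantumReferenceFrame G Ω H) (W : UnitaryRep G K) (A : K →L[ℂ] K) (φ : H) (ψ : K) :
    Integrable (fun x => ⟪ψ, W.conj (groupCoord hΩ o x) A ψ⟫_ℂ) (R.povm.outcomeMeasure φ) :=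
  integrable_inner_apply R.povm (fun _ => W.norm_conj_le _ A) (fun ψ =>
    ((W.continuous_inner_conj A ψ ψ).comp (groupCoord hΩ o).continuous).measurable) φ ψ

theorem outcomeMeasure_rep (R : QuantumReferenceFrame G Ω H) (g : G) (φ : H) :
    R.povm.outcomeMeasure ((R.rep.U g : H →L[ℂ] H) φ) =
      (R.povm.outcomeMeasure φ).map (fun x => g • x) := by
  have hg : Measurable fun x : Ω => g • x := (continuous_const_smul g).measurable
  ext X hX
  rw [Measure.map_apply hg hX, R.povm.outcomeMeasure_apply hX,
    R.povm.outcomeMeasure_apply (hg hX)]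
  have h1 : (fun x : Ω => g • x) ⁻¹' X = (fun x : Ω => g⁻¹ • x) '' X := by
    ext x
    simp only [Set.mem_preimage, Set.mem_image]
    exact ⟨fun h => ⟨g • x, h, by simp⟩, by rintro ⟨y, hy, rfl⟩; simpa using hy⟩
  rw [h1, R.covariant g⁻¹ X hX, R.rep.inner_conj, inv_inv]

theorem relativizationOp_mem (hΩ : IsPrincipalHomogeneousSpace G Ω) (o : Ω)
    (R : QuantumReferenceFrame G Ω H) (W : UnitaryRep G K) (A : K →L[ℂ] K) :
    relativizationOp hΩ o R W A ∈ invariantOperators R.rep W := by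
  intro g
  refine IsOperatorIntegral.unique (fun φ ψ => ?_) (relativizationOp_spec hΩ o R W A)
  have hst : star (prodOp (R.rep.U g : H →L[ℂ] H) (W.U g : K →L[ℂ] K)) =
      prodOp (R.rep.U g⁻¹ : H →L[ℂ] H) (W.U g⁻¹ : K →L[ℂ] K) := by
    rw [ContinuousLinearMap.star_eq_adjoint, prodOp_adjoint, ← ContinuousLinearMap.star_eq_adjoint,
      ← ContinuousLinearMap.star_eq_adjoint, R.rep.star_U, W.star_U]
  rw [mul_apply_eq_comp, mul_apply_eq_comp, ← ContinuousLinearMap.adjoint_inner_left,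
    ← ContinuousLinearMap.star_eq_adjoint, hst, prodOp_prodVec,
    relativizationOp_spec hΩ o R W A, outcomeMeasure_rep, integral_map]
  · refine integral_congr_ae (Eventually.of_forall fun x => ?_)
    simp only [groupCoord_smul, UnitaryRep.conj_mul]
    have hU : (W.U g : K →L[ℂ] K) ((W.U g⁻¹ : K →L[ℂ] K) ψ) = ψ := by
      rw [← mul_apply_eq_comp, ← Submonoid.coe_mul, ← map_mul]
      simp
    rw [W.inner_conj g⁻¹, inv_inv, hU]
  · exact (continuous_const_smul g⁻¹).measurable.aemeasurable
  · exact ((W.continuous_inner_conj A _ _).comp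
      (groupCoord hΩ o).continuous).measurable.aestronglyMeasurable

/-- The relativization map `A ↦ ∫ dE(g) ⊗ U(g) A U(g)^*`, a linear map from `B(K)` to the invariant
operators `B(H ⊗ K)^G`. -/
def relativization (hΩ : IsPrincipalHomogeneousSpace G Ω) (o : Ω)
    (R : QuantumReferenceFrame G Ω H) (W : UnitaryRep G K) :
    (K →L[ℂ] K) →ₗ[ℂ] invariantOperators R.rep W where
  toFun A := ⟨relativizationOp hΩ o R W A, relativizationOp_mem hΩ o R W A⟩
  map_add' A B := Subtype.ext <| (relativizationOp_spec hΩ o R W (A + B)).unique fun φ ψ => by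
    have h := integral_add (integrable_relativization hΩ o R W A φ ψ)
      (integrable_relativization hΩ o R W B φ ψ)
    simp only [Submodule.coe_add, add_apply, inner_add_right,
      relativizationOp_spec hΩ o R W A φ ψ, relativizationOp_spec hΩ o R W B φ ψ, ← h]
    refine integral_congr_ae (Eventually.of_forall fun x => ?_)
    simp [UnitaryRep.conj, mul_add, add_mul]
  map_smul' c A := Subtype.ext <| (relativizationOp_spec hΩ o R W (c • A)).unique fun φ ψ => by
    simp only [Submodule.coe_smul, smul_apply, inner_smul_right, RingHom.id_apply,
      relativizationOp_spec hΩ o R W A φ ψ, ← integral_const_mul]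
    refine integral_congr_ae (Eventually.of_forall fun x => ?_)
    simp [UnitaryRep.conj]

end Frames

end

/-!
By covariance and the Lindelöf property, a nonempty open set that is null for the frame observable
would have countably many null translates covering the whole space, so the observable charges every
nonempty open set. Localizability then yields unit vectors `φ i` whose outcome distributions
concentrate at the base point `o`. Compressing `¥(A)` to `φ i ⊗ K` does not increase its norm and
gives the average of `U(g) A U(g)^*` over the outcome distribution of `φ i`. As
`g ↦ U(g) A U(g)^*` is bounded and weakly continuous with value `A` at the identity, these
compressions converge weakly to `A`. The operator norm is weakly lower semicontinuous, so
`‖A‖ ≤ ‖¥(A)‖`.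
-/

section BoundedOperators

theorem exists_norm_eq_one_lt_re_inner {𝕜 H : Type*} [RCLike 𝕜] [NormedAddCommGroup H]
    [InnerProductSpace 𝕜 H] {A : H →L[𝕜] H} (hA : A.IsPositive) {r : ℝ} (hr₀ : 0 ≤ r)
    (hr : r < ‖A‖) : ∃ φ : H, ‖φ‖ = 1 ∧ r < RCLike.re ⟪φ, A φ⟫_𝕜 := by
  rw [A.norm_eq_iSup_rayleighQuotient hA.isSymmetric] at hr
  obtain ⟨ψ, hψ⟩ := exists_lt_of_lt_ciSup hr
  rw [abs_of_nonneg (div_nonneg (hA.2 ψ) (sq_nonneg _))] at hψ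
  have hψ₀ : ψ ≠ 0 := by
    rintro rfl
    exact (hr₀.trans_lt hψ).ne' A.rayleighQuotient_apply_zero
  obtain ⟨φ, hφ, hφψ⟩ :=
    (A.image_rayleigh_eq_image_rayleigh_sphere one_pos).subset ⟨ψ, hψ₀, rfl⟩
  have hφ₁ : ‖φ‖ = 1 := mem_sphere_zero_iff_norm.1 hφ
  have hφr : r < A.rayleighQuotient φ := hψ.trans_eq hφψ.symm
  rw [ContinuousLinearMap.rayleighQuotient, hφ₁, one_pow, div_one, A.reApplyInnerSelf_apply,
    inner_re_symm] at hφr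
  exact ⟨φ, hφ₁, hφr⟩

variable {K : Type*} [NormedAddCommGroup K] [InnerProductSpace ℂ K] {ι : Type*} {l : Filter ι}
  {S : ι → K →L[ℂ] K} {A : K →L[ℂ] K}

theorem tendsto_inner_map_of_tendsto_inner_map_self
    (h : ∀ ψ, Tendsto (fun i => ⟪ψ, S i ψ⟫_ℂ) l (𝓝 ⟪ψ, A ψ⟫_ℂ)) (ψ ψ' : K) :
    Tendsto (fun i => ⟪S i ψ, ψ'⟫_ℂ) l (𝓝 ⟪A ψ, ψ'⟫_ℂ) := by
  have h' : ∀ χ, Tendsto (fun i => ⟪S i χ, χ⟫_ℂ) l (𝓝 ⟪A χ, χ⟫_ℂ) := fun χ => by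
    simpa only [Function.comp_def, inner_conj_symm] using
      (Complex.continuous_conj.tendsto _).comp (h χ)
  have polarization (B : K →L[ℂ] K) := inner_map_polarization' (B : K →ₗ[ℂ] K) ψ ψ'
  simp only [ContinuousLinearMap.coe_coe] at polarization
  simp only [polarization]
  exact ((((h' _).sub (h' _)).sub ((h' _).const_mul _)).add ((h' _).const_mul _)).div_const 4

theorem norm_le_of_tendsto_inner_map_self [l.NeBot] {M : ℝ} (hS : ∀ i, ‖S i‖ ≤ M)
    (h : ∀ ψ, Tendsto (fun i => ⟪ψ, S i ψ⟫_ℂ) l (𝓝 ⟪ψ, A ψ⟫_ℂ)) : ‖A‖ ≤ M := by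
  obtain ⟨i⟩ := l.nonempty_of_neBot
  refine ContinuousLinearMap.opNorm_le_of_re_inner_le (𝕜 := ℂ) ((norm_nonneg _).trans (hS i))
    fun ψ ψ' hψ hψ' => ?_
  refine le_of_tendsto ((Complex.continuous_re.tendsto _).comp
    (tendsto_inner_map_of_tendsto_inner_map_self h ψ ψ')) (Eventually.of_forall fun j => ?_)
  calc (⟪S j ψ, ψ'⟫_ℂ).re ≤ ‖S j ψ‖ * ‖ψ'‖ := re_inner_le_norm (𝕜 := ℂ) _ _
    _ ≤ M := by simpa only [hψ, hψ', mul_one] using (S j).le_of_opNorm_le (hS j) ψ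

end BoundedOperators

section ConcentratingMeasures

variable {Ω : Type*} [MeasurableSpace Ω] {E : Type*} [NormedAddCommGroup E] [NormedSpace ℝ E]
  {h : Ω → E} {C : ℝ}

theorem norm_integral_le_add_measureReal_compl {μ : Measure Ω} [IsProbabilityMeasure μ]
    (hh : Integrable h μ) {U : Set Ω} (hU : MeasurableSet U) (hC : ∀ y ∈ Uᶜ, ‖h y‖ ≤ C) {ε : ℝ}
    (hε : 0 ≤ ε) (hUε : ∀ y ∈ U, ‖h y‖ ≤ ε) : ‖∫ y, h y ∂μ‖ ≤ ε + C * μ.real Uᶜ :=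
  calc ‖∫ y, h y ∂μ‖ = ‖∫ y in U, h y ∂μ + ∫ y in Uᶜ, h y ∂μ‖ := by
        rw [integral_add_compl hU hh]
    _ ≤ ‖∫ y in U, h y ∂μ‖ + ‖∫ y in Uᶜ, h y ∂μ‖ := norm_add_le _ _
    _ ≤ ε * μ.real U + C * μ.real Uᶜ := add_le_add
        (norm_setIntegral_le_of_norm_le_const (measure_lt_top _ _) hUε)
        (norm_setIntegral_le_of_norm_le_const (measure_lt_top _ _) hC)
    _ ≤ ε + C * μ.real Uᶜ := by gcongr; exact mul_le_of_le_one_right hε measureReal_le_one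

theorem tendsto_integral_of_tendsto_measureReal_compl [CompleteSpace E] [TopologicalSpace Ω]
    [OpensMeasurableSpace Ω] {ι : Type*} {l : Filter ι} {μ : ι → Measure Ω}
    [∀ i, IsProbabilityMeasure (μ i)] {x : Ω}
    (hμ : ∀ U, IsOpen U → x ∈ U → Tendsto (fun i => (μ i).real Uᶜ) l (𝓝 0))
    (hh : StronglyMeasurable h) (hC : ∀ y, ‖h y‖ ≤ C) (hx : ContinuousAt h x) :
    Tendsto (fun i => ∫ y, h y ∂(μ i)) l (𝓝 (h x)) := by
  rw [Metric.tendsto_nhds]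
  intro ε hε
  obtain ⟨U, hUε, hU, hxU⟩ := eventually_nhds_iff.1 (Metric.tendsto_nhds.1 hx (ε / 2) (half_pos hε))
  have hμU : Tendsto (fun i => ε / 2 + (C + C) * (μ i).real Uᶜ) l (𝓝 (ε / 2)) := by
    simpa only [mul_zero, add_zero] using ((hμ U hU hxU).const_mul (C + C)).const_add (ε / 2)
  filter_upwards [hμU.eventually_lt_const (half_lt_self hε)] with i hi
  have hint : Integrable h (μ i) :=
    .of_bound hh.aestronglyMeasurable C (Eventually.of_forall hC)
  refine lt_of_le_of_lt ?_ hi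
  calc dist (∫ y, h y ∂(μ i)) (h x) = ‖∫ y, (h y - h x) ∂(μ i)‖ := by
        rw [integral_sub hint (integrable_const _), integral_const, probReal_univ, one_smul,
          dist_eq_norm]
    _ ≤ ε / 2 + (C + C) * (μ i).real Uᶜ :=
        norm_integral_le_add_measureReal_compl (hint.sub (integrable_const _)) hU.measurableSet
          (fun y _ => norm_sub_le_of_le (hC y) (hC x)) (half_pos hε).le
          fun y hy => (dist_eq_norm (h y) (h x)).ge.trans (hUε y hy).le

end ConcentratingMeasures

namespace POVM

variable {Ω : Type*} [MeasurableSpace Ω] {H : Type*} [NormedAddCommGroup H]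
  [InnerProductSpace ℂ H] {E : POVM Ω H}

theorem isProbabilityMeasure_outcomeMeasure (E : POVM Ω H) {φ : H} (hφ : ‖φ‖ = 1) :
    IsProbabilityMeasure (E.outcomeMeasure φ) :=
  ⟨by rw [E.outcomeMeasure_univ, hφ, one_pow, ENNReal.ofReal_one]⟩

/-- A localizing family of unit vectors at `x`: the outcome distributions concentrate at `x`
along the filter `l`. -/
structure IsLocalizingAt [TopologicalSpace Ω] {ι : Type*} (E : POVM Ω H) (l : Filter ι)
    (φ : ι → H) (x : Ω) : Prop where
  norm_eq_one : ∀ i, ‖φ i‖ = 1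
  tendsto_outcomeMeasure_compl : ∀ U, IsOpen U → x ∈ U →
    Tendsto (fun i => (E.outcomeMeasure (φ i)).real Uᶜ) l (𝓝 0)

theorem IsLocalizable.exists_outcomeMeasure_compl_lt (hE : E.IsLocalizable) {X : Set Ω}
    (hX : MeasurableSet X) (hEX : E.effect X ≠ 0) {ε : ℝ} (hε : 0 < ε) :
    ∃ φ : H, ‖φ‖ = 1 ∧ (E.outcomeMeasure φ).real Xᶜ < ε := by
  obtain ⟨φ, hφ, hφX⟩ := exists_norm_eq_one_lt_re_inner (E.effect_isPositive X hX)
    (le_max_left 0 (1 - ε)) (by rw [hE X hX hEX]; exact max_lt one_pos (by linarith))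
  have := E.isProbabilityMeasure_outcomeMeasure hφ
  have hreal : (E.outcomeMeasure φ).real X = (⟪φ, E.effect X φ⟫_ℂ).re := by
    rw [← E.outcomeMeasure_real hX, Complex.ofReal_re]
  have hφε : 1 - ε < (⟪φ, E.effect X φ⟫_ℂ).re := (le_max_right 0 (1 - ε)).trans_lt hφX
  refine ⟨φ, hφ, ?_⟩
  rw [probReal_compl_eq_one_sub hX, hreal]
  linarith

theorem IsLocalizable.exists_isLocalizingAt [TopologicalSpace Ω] [OpensMeasurableSpace Ω]
    (hE : E.IsLocalizable) {x : Ω} (hx : ∀ U, IsOpen U → x ∈ U → E.effect U ≠ 0) :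
    ∃ φ : ℕ × TopologicalSpace.OpenNhdsOf x → H, E.IsLocalizingAt (atTop ×ˢ atBot) φ x := by
  choose φ hφ hφU using fun i : ℕ × TopologicalSpace.OpenNhdsOf x =>
    hE.exists_outcomeMeasure_compl_lt i.2.isOpen.measurableSet (hx _ i.2.isOpen i.2.mem)
      (Nat.one_div_pos_of_nat (α := ℝ) (n := i.1))
  refine ⟨φ, hφ, fun U hU hxU => ?_⟩
  have hlim : Tendsto (fun i : ℕ × TopologicalSpace.OpenNhdsOf x => 1 / ((i.1 : ℝ) + 1))
      (atTop ×ˢ atBot) (𝓝 0) := tendsto_one_div_add_atTop_nhds_zero_nat.comp tendsto_fst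
  refine squeeze_zero' (Eventually.of_forall fun i => measureReal_nonneg) ?_ hlim
  filter_upwards [tendsto_snd.eventually (eventually_le_atBot ⟨⟨U, hU⟩, hxU⟩)] with i hi
  exact (measureReal_mono (Set.compl_subset_compl.2 hi)).trans (hφU i).le

end POVM

section Restriction

variable {H K : Type*} [NormedAddCommGroup H] [InnerProductSpace ℂ H]
  [NormedAddCommGroup K] [InnerProductSpace ℂ K]

theorem norm_prodVec (φ : H) (ψ : K) : ‖prodVec φ ψ‖ = ‖φ‖ * ‖ψ‖ := by
  rw [prodVec, UniformSpace.Completion.norm_coe, TensorProduct.norm_tmul]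

/-- The bounded operator `ψ ↦ φ ⊗ ψ`. -/
noncomputable def prodVecL (φ : H) : K →L[ℂ] HilbertTensor H K :=
  UniformSpace.Completion.toComplL ∘L TensorProduct.mkL ℂ H K φ

theorem prodVecL_apply (φ : H) (ψ : K) : prodVecL φ ψ = prodVec φ ψ := rfl

theorem norm_prodVecL_le (φ : H) : ‖(prodVecL φ : K →L[ℂ] HilbertTensor H K)‖ ≤ ‖φ‖ :=
  ContinuousLinearMap.opNorm_le_bound _ (norm_nonneg φ) fun ψ => (norm_prodVec φ ψ).le

variable [CompleteSpace K]

/-- The restriction map `Γ_φ`: the compression of an operator on `H ⊗ K` to the subspace `φ ⊗ K`,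
read as an operator on `K`. -/
noncomputable def restriction (φ : H) (T : HilbertTensor H K →L[ℂ] HilbertTensor H K) : K →L[ℂ] K :=
  ContinuousLinearMap.adjoint (prodVecL φ) ∘L T ∘L prodVecL φ

theorem inner_restriction (φ : H) (T : HilbertTensor H K →L[ℂ] HilbertTensor H K) (ψ ψ' : K) :
    ⟪ψ, restriction φ T ψ'⟫_ℂ = ⟪prodVec φ ψ, T (prodVec φ ψ')⟫_ℂ :=
  ContinuousLinearMap.adjoint_inner_right (prodVecL φ) ψ (T (prodVec φ ψ'))

theorem norm_restriction_le (φ : H) (T : HilbertTensor H K →L[ℂ] HilbertTensor H K) :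
    ‖restriction φ T‖ ≤ ‖φ‖ ^ 2 * ‖T‖ :=
  calc ‖restriction φ T‖ ≤ ‖ContinuousLinearMap.adjoint (prodVecL φ : K →L[ℂ] HilbertTensor H K)‖ *
        (‖T‖ * ‖(prodVecL φ : K →L[ℂ] HilbertTensor H K)‖) :=
        (ContinuousLinearMap.opNorm_comp_le _ _).trans
          (by gcongr; exact ContinuousLinearMap.opNorm_comp_le _ _)
    _ ≤ ‖φ‖ * (‖T‖ * ‖φ‖) := by
        rw [LinearIsometryEquiv.norm_map]
        gcongr <;> exact norm_prodVecL_le φ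
    _ = ‖φ‖ ^ 2 * ‖T‖ := by ring

end Restriction

namespace IsOperatorIntegral

variable {Ω : Type*} [TopologicalSpace Ω] [MeasurableSpace Ω] [OpensMeasurableSpace Ω]
  {H K : Type*} [NormedAddCommGroup H] [InnerProductSpace ℂ H] [NormedAddCommGroup K]
  [InnerProductSpace ℂ K] [CompleteSpace K] {E : POVM Ω H} {f : Ω → (K →L[ℂ] K)}
  {T : HilbertTensor H K →L[ℂ] HilbertTensor H K} {ι : Type*} {l : Filter ι} {φ : ι → H} {x : Ω}
  {M : ℝ}

theorem tendsto_inner_restriction (hT : IsOperatorIntegral E f T) (hφ : E.IsLocalizingAt l φ x)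
    (hM : ∀ y, ‖f y‖ ≤ M) {ψ : K} (hf : Measurable fun y => ⟪ψ, f y ψ⟫_ℂ)
    (hfx : ContinuousAt (fun y => ⟪ψ, f y ψ⟫_ℂ) x) :
    Tendsto (fun i => ⟪ψ, restriction (φ i) T ψ⟫_ℂ) l (𝓝 ⟪ψ, f x ψ⟫_ℂ) := by
  have (i : ι) : IsProbabilityMeasure (E.outcomeMeasure (φ i)) :=
    E.isProbabilityMeasure_outcomeMeasure (hφ.norm_eq_one i)
  simp only [inner_restriction, hT _ _]
  exact tendsto_integral_of_tendsto_measureReal_compl hφ.tendsto_outcomeMeasure_compl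
    hf.stronglyMeasurable (norm_inner_apply_le hM ψ) hfx

theorem norm_apply_le [l.NeBot] (hT : IsOperatorIntegral E f T) (hφ : E.IsLocalizingAt l φ x)
    (hM : ∀ y, ‖f y‖ ≤ M) (hf : ∀ ψ, Measurable fun y => ⟪ψ, f y ψ⟫_ℂ)
    (hfx : ∀ ψ, ContinuousAt (fun y => ⟪ψ, f y ψ⟫_ℂ) x) : ‖f x‖ ≤ ‖T‖ :=
  norm_le_of_tendsto_inner_map_self
    (fun i => by simpa only [hφ.norm_eq_one i, one_pow, one_mul] using norm_restriction_le (φ i) T)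
    fun ψ => hT.tendsto_inner_restriction hφ hM (hf ψ) (hfx ψ)

end IsOperatorIntegral

section RelativizationNorm

variable {G : Type*} [Group G] [TopologicalSpace G]

theorem groupCoord_base {Ω : Type*} [TopologicalSpace Ω] [MulAction G Ω]
    (hΩ : IsPrincipalHomogeneousSpace G Ω) (o : Ω) : groupCoord hΩ o o = 1 :=
  ((hΩ o).homeomorph _).symm_apply_eq.2 (one_smul G o).symm

variable {H K : Type*} [NormedAddCommGroup H] [InnerProductSpace ℂ H] [CompleteSpace H]
  [NormedAddCommGroup K] [InnerProductSpace ℂ K] [CompleteSpace K]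

theorem UnitaryRep.conj_one (V : UnitaryRep G H) (A : H →L[ℂ] H) : V.conj 1 A = A := by
  rw [UnitaryRep.conj, map_one, OneMemClass.coe_one, star_one, one_mul, mul_one]

theorem UnitaryRep.conj_zero (V : UnitaryRep G H) (g : G) : V.conj g 0 = 0 := by
  rw [UnitaryRep.conj, mul_zero, zero_mul]

variable {Ω : Type*} [TopologicalSpace Ω] [MeasurableSpace Ω] [BorelSpace Ω] [MulAction G Ω]
  [ContinuousSMul G Ω] [MulAction.IsPretransitive G Ω] [LindelofSpace Ω] [Nontrivial H]

theorem QuantumReferenceFrame.effect_ne_zero_of_isOpen (R : QuantumReferenceFrame G Ω H)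
    {U : Set Ω} (hU : IsOpen U) (hne : U.Nonempty) : R.povm.effect U ≠ 0 := by
  intro hRU
  obtain ⟨x₀, hx₀⟩ := hne
  obtain ⟨φ, hφ⟩ := exists_ne (0 : H)
  choose g hg using MulAction.exists_smul_eq G x₀
  have hopen (x : Ω) : IsOpen ((fun y => g x • y) '' U) := isOpenMap_smul (g x) U hU
  obtain ⟨s, hs, hcover⟩ := countable_cover_nhds fun x => (hopen x).mem_nhds ⟨x₀, hx₀, hg x⟩
  have hnull (x : Ω) : R.povm.outcomeMeasure φ ((fun y => g x • y) '' U) = 0 := by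
    rw [R.povm.outcomeMeasure_apply (hopen x).measurableSet, R.covariant _ _ hU.measurableSet,
      hRU, UnitaryRep.conj_zero, zero_apply, inner_zero_right, Complex.zero_re,
      ENNReal.ofReal_zero]
  have huniv : R.povm.outcomeMeasure φ Set.univ = 0 := by
    rw [← hcover]
    exact (measure_biUnion_null_iff hs).2 fun x _ => hnull x
  rw [R.povm.outcomeMeasure_univ, ENNReal.ofReal_eq_zero] at huniv
  exact huniv.not_gt (by positivity)

theorem norm_relativizationOp [IsTopologicalGroup G] (hΩ : IsPrincipalHomogeneousSpace G Ω) (o : Ω)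
    (R : QuantumReferenceFrame G Ω H) (hR : R.IsLocalizable) (W : UnitaryRep G K)
    (A : K →L[ℂ] K) : ‖relativizationOp hΩ o R W A‖ = ‖A‖ := by
  refine le_antisymm (exists_relativization hΩ o R W A).choose_spec.1 ?_
  obtain ⟨φ, hφ⟩ := POVM.IsLocalizable.exists_isLocalizingAt hR
    fun U hU hoU => R.effect_ne_zero_of_isOpen hU ⟨o, hoU⟩
  have hcont (ψ : K) : Continuous fun x => ⟪ψ, W.conj (groupCoord hΩ o x) A ψ⟫_ℂ :=
    (W.continuous_inner_conj A ψ ψ).comp (groupCoord hΩ o).continuous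
  simpa only [groupCoord_base, W.conj_one] using
    (relativizationOp_spec hΩ o R W A).norm_apply_le hφ (fun _ => W.norm_conj_le _ A)
      (fun ψ => (hcont ψ).measurable) fun ψ => (hcont ψ).continuousAt

end RelativizationNorm

theorem mainTheorem4_general
    {G : Type*} [Group G] [TopologicalSpace G] [IsTopologicalGroup G] [LindelofSpace G]
    {Ω : Type*} [TopologicalSpace Ω] [MeasurableSpace Ω] [BorelSpace Ω] [MulAction G Ω]
    [ContinuousSMul G Ω] [MulAction.IsPretransitive G Ω]
    {HR : Type*} [NormedAddCommGroup HR] [InnerProductSpace ℂ HR] [CompleteSpace HR] [Nontrivial HR]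
    {HS : Type*} [NormedAddCommGroup HS] [InnerProductSpace ℂ HS] [CompleteSpace HS]
    (hΩ : IsPrincipalHomogeneousSpace G Ω) (o : Ω)
    (R : QuantumReferenceFrame G Ω HR) (hR : R.IsLocalizable)
    (US : UnitaryRep G HS) :
    Isometry (relativization hΩ o R US) ∧ Function.Injective (relativization hΩ o R US) := by
  have : LindelofSpace Ω := .of_continuous_surjective (groupCoord hΩ o).symm.continuous
    (groupCoord hΩ o).symm.surjective
  have hiso : Isometry (relativization hΩ o R US) :=
    AddMonoidHomClass.isometry_of_norm (relativization hΩ o R US)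
      (norm_relativizationOp hΩ o R hR US)
  exact ⟨hiso, hiso.injective⟩

/-- The relativization map of a localizable principal frame is isometric, hence injective. -/
theorem mainTheorem4
    {G : Type*} [Group G] [TopologicalSpace G] [IsTopologicalGroup G] [T2Space G]
    [LocallyCompactSpace G] [SecondCountableTopology G]
    {Ω : Type*} [TopologicalSpace Ω] [MeasurableSpace Ω] [BorelSpace Ω] [MulAction G Ω]
    [ContinuousSMul G Ω] [MulAction.IsPretransitive G Ω]
    {HR : Type*} [NormedAddCommGroup HR] [InnerProductSpace ℂ HR] [CompleteSpace HR] [Nontrivial HR]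
    {HS : Type*} [NormedAddCommGroup HS] [InnerProductSpace ℂ HS] [CompleteSpace HS]
    (hΩ : IsPrincipalHomogeneousSpace G Ω) (o : Ω)
    (R : QuantumReferenceFrame G Ω HR) (hR : R.IsLocalizable)
    (US : UnitaryRep G HS) :
    Isometry (relativization hΩ o R US) ∧ Function.Injective (relativization hΩ o R US) :=
  mainTheorem4_general hΩ o R hR US
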